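/- All theories are first-order theories in the language $\{=,\in,A\}$, $A$ a unary relation symbol, and are assumed to include the axiom $V=L[A]$, so that every transitive model $(M,\in,A)$ of such a theory has the form $(L_\alpha[A],\in,A)$ with $\alpha=M\cap\mathrm{Ord}$. Let $S$ be the class of ordinals $\alpha$ for which there is such a theory $T$ with $\alpha=\max\{M\cap\mathrm{Ord} : M\models T \text{ a transitive set model}\}$. Let $\mathfrak{Sp}_T$ be the class of ordinals $\alpha$ for which there is a transitive set model $M\models T$ with $M\cap \mathrm{Ord}=\alpha$ that is maximal, i.e. there are no transitive structure $N$ and non-trivial (not the identity $M\to M$) elementary embedding $j\colon M\to N$; and let $\mathfrak{Sp}=\bigcup_T\mathfrak{Sp}_T$. **Lemma.** Let $\kappa$ be a measurable cardinal. Then: 1. $\mathfrak{Sp}\cup S\subseteq\kappa$. 2. Let $(M,\in,A)$ be any structure with $M$ a transitive set, $A\subseteq M$ and $\alpha=M\cap\mathrm{Ord}\ge\kappa$, let $U$ be a $\kappa$-complete nonprincipal ultrafilter on $\kappa$, and let $\theta>\alpha$ be an ordinal. Then the $\theta$-th iterated ultrapower embedding $j\colon V\to N$ of the universe by $U$, with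 $N$ a transitive class, exists; it is elementary, has critical point $\kappa$ and satisfies $j(\kappa)>\alpha$. Moreover $(j(M),\in,j(A))$ is a transitive structure of height $j(M)\cap\mathrm{Ord}>\alpha$, and $j\restriction M\colon (M,\in,A)\to (j(M),\in,j(A))$ is a non-trivial elementary embedding. -/

import Mathlib

open FirstOrder Cardinal

universe u

namespace TransitiveSpectra

/-! ### The languages `{∈}` and `{∈, A}` (equality is a logical symbol) -/

/-- The relation symbols of the language `{∈}`. -/
inductive MemRel : ℕ → Type
  | mem : MemRel 2

/-- The relation symbols of the language `{∈, A}`, where `A` is unary. -/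
inductive MemPredRel : ℕ → Type
  | mem : MemPredRel 2
  | pred : MemPredRel 1

/-- The language `{=, ∈}`. -/
def memLang : FirstOrder.Language.{0, 0} := ⟨fun _ => Empty, MemRel⟩

/-- The language `{=, ∈, A}`. -/
def memPredLang : FirstOrder.Language.{0, 0} := ⟨fun _ => Empty, MemPredRel⟩

/-- The structure `(V, ∈)`. -/
instance universeStructure : memLang.Structure ZFSet.{u} where
  funMap f := Empty.elim f
  RelMap {_} r := match r with
    | MemRel.mem => fun v => v 0 ∈ v 1

/-- The structure `(N, ∈)`, for a class `N`. -/
instance classStructure (N : Set ZFSet.{u}) : memLang.Structure N where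
  funMap f := Empty.elim f
  RelMap {_} r := match r with
    | MemRel.mem => fun v => (v 0 : ZFSet.{u}) ∈ (v 1 : ZFSet.{u})

/-- A set `M` together with a set `A`, giving the structure `(M, ∈, A)`. -/
structure SetStr where
  carrier : ZFSet.{u}
  pred : ZFSet.{u}

namespace SetStr

/-- The domain of `(M, ∈, A)` as a type. -/
def Dom (M : SetStr.{u}) : Type (u + 1) := {x : ZFSet.{u} // x ∈ M.carrier}

instance (M : SetStr.{u}) : memPredLang.Structure M.Dom where
  funMap f := Empty.elim f
  RelMap {_} r := match r with
    | MemPredRel.mem => fun v => (v 0).1 ∈ (v 1).1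
    | MemPredRel.pred => fun v => (v 0).1 ∈ M.pred

/-- `(M, ∈, A)` is a transitive structure: `M` is a transitive set and `A ⊆ M`. -/
def IsTransitive (M : SetStr.{u}) : Prop :=
  M.carrier.IsTransitive ∧ M.pred ⊆ M.carrier

/-- `M ∩ Ord = α`. -/
def HasHeight (M : SetStr.{u}) (α : Ordinal.{u}) : Prop :=
  M.carrier.sep ZFSet.IsOrdinal = α.toZFSet

/-- An elementary embedding `j : (M, ∈, A) → (N, ∈, B)` is non-trivial if it is not the identity
of `M`: either `N ≠ M`, or `j` moves some element. -/
def Nontrivial {M N : SetStr.{u}} (j : M.Dom ↪ₑ[memPredLang] N.Dom) : Prop :=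
  N.carrier ≠ M.carrier ∨ ∃ x : M.Dom, (j x).1 ≠ x.1

/-- `M` is maximal: there is no non-trivial elementary embedding of `M` into a transitive
structure. -/
def IsMaximal (M : SetStr.{u}) : Prop :=
  ¬ ∃ N : SetStr.{u}, N.IsTransitive ∧ ∃ j : M.Dom ↪ₑ[memPredLang] N.Dom, Nontrivial j

end SetStr

/-! ### Relative constructibility -/

/-- `Def_A(x)`: the set of the subsets of `x` that are first-order definable with parameters over
`(x, ∈, A ∩ x)`. -/
noncomputable def defPower (A x : ZFSet.{u}) : ZFSet.{u} :=
  x.powerset.sep fun y =>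
    (Set.univ : Set (SetStr.mk x (A ∩ x)).Dom).Definable₁ memPredLang {z | z.1 ∈ y}

/-- The hierarchy relative to the predicate `A`: `L_α[A] = ⋃_{β < α} Def_A(L_β[A])`. -/
noncomputable def constructible (A : ZFSet.{u}) (α : Ordinal.{u}) : ZFSet.{u} :=
  ZFSet.iUnion fun β : Set.Iio α => defPower A (constructible A β.1)
termination_by α
decreasing_by exact β.2

/-- The transitive structure `(M, ∈, A)` satisfies `V = L[A]`, that is `M = L_α[A]` for
`α = M ∩ Ord`. -/
def SetStr.IsConstructible (M : SetStr.{u}) : Prop :=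
  ∃ α, M.HasHeight α ∧ M.carrier = constructible M.pred α

/-- The theory `T` includes the axiom `V = L[A]`, as far as transitive models are concerned: every
transitive model `(M, ∈, A)` of `T` is of the form `(L_α[A], ∈, A)`. This holds in particular of
every `T` that contains some sentence whose transitive models are of this form. -/
def IncludesVEqLA (T : memPredLang.Theory) : Prop :=
  ∀ M : SetStr.{u}, M.IsTransitive → M.Dom ⊨ T → M.IsConstructible

/-! ### The spectra -/

/-- The class `S` of all `α` such that, for some theory `T` that includes `V = L[A]`, `α` is the
maximal height of a transitive model of `T`. -/
def S : Set Ordinal.{u} :=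
  {α | ∃ T : memPredLang.Theory, IncludesVEqLA.{u} T ∧
    IsGreatest {β | ∃ M : SetStr.{u}, M.IsTransitive ∧ M.Dom ⊨ T ∧ M.HasHeight β} α}

/-- The class `𝔖𝔭_T` of the heights of the maximal transitive models of `T`. -/
def SpTheory (T : memPredLang.Theory) : Set Ordinal.{u} :=
  {α | ∃ M : SetStr.{u}, M.IsTransitive ∧ M.Dom ⊨ T ∧ M.HasHeight α ∧ M.IsMaximal}

/-- `𝔖𝔭 = ⋃_T 𝔖𝔭_T`, over all theories `T` that include `V = L[A]`. -/
def Sp : Set Ordinal.{u} :=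
  {α | ∃ T : memPredLang.Theory, IncludesVEqLA.{u} T ∧ α ∈ SpTheory.{u} T}

/-! ### Measurable cardinals -/

/-- `U` is a measure on `κ`: a `κ`-complete nonprincipal ultrafilter on the ordinals below `κ`. -/
def IsMeasureOn (κ : Cardinal.{u}) (U : Ultrafilter κ.ord.ToType) : Prop :=
  CardinalInterFilter (U : Filter κ.ord.ToType) κ ∧ ∀ ξ, {ξ} ∉ U

/-- `κ` is a measurable cardinal. -/
def IsMeasurableCardinal (κ : Cardinal.{u}) : Prop :=
  ℵ₀ < κ ∧ ∃ U : Ultrafilter κ.ord.ToType, IsMeasureOn κ U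

/-! ### Iterated ultrapowers of the universe

The `θ`-th iterate of the ultrapower of `V` by `U` is presented through the finite powers of `U`:
it is the transitive collapse of the class of all functions `F : κ^θ → V` that depend on finitely
many coordinates, modulo the quantifier "for almost all `x`" given by the powers `U^s`, for finite
`s ⊆ θ`. -/

section Iteration

variable {K I : Type u}

/-- `∀^U ξ₁ ∀^U ξ₂ … ∀^U ξₙ, P (x[i₁ ↦ ξ₁, …, iₙ ↦ ξₙ])`, for the list `[i₁, …, iₙ]`. -/
def iteratedForall [DecidableEq I] (U : Ultrafilter K) :
    List I → ((I → K) → Prop) → (I → K) → Prop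
  | [], P, x => P x
  | i :: l, P, x => ∀ᶠ ξ in (U : Filter K), iteratedForall U l P (Function.update x i ξ)

/-- `P` depends only on the coordinates in a finite set `s = {i₁ < … < iₙ}` and
`∀^U ξ₁ … ∀^U ξₙ, P (…, i₁ ↦ ξ₁, …, iₙ ↦ ξₙ, …)`, i.e. the set defined by `P` belongs to `U^s`. -/
def AlmostAll [LinearOrder I] (U : Ultrafilter K) (P : (I → K) → Prop) : Prop :=
  ∃ s : Finset I, DependsOn P (s : Set I) ∧ ∀ x, iteratedForall U s.sort P x

/-- The functions on `κ^θ` that depend on finitely many coordinates. -/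
def FinSupp (K I : Type u) : Type (u + 1) :=
  {F : (I → K) → ZFSet.{u} // ∃ s : Finset I, DependsOn F (s : Set I)}

/-- The constant function with value `a`. -/
def FinSupp.const (a : ZFSet.{u}) : FinSupp K I :=
  ⟨fun _ => a, ∅, fun _ _ _ => rfl⟩

end Iteration

/-- `N` is the (transitive collapse of the) `θ`-th iterated ultrapower of `V` by the ultrafilter
`U` on `κ`, with embedding `j : V → N`; here `cls F` is the element of `N` represented by `F`. -/
def IsIteratedUltrapower {κ : Cardinal.{u}} (U : Ultrafilter κ.ord.ToType) (θ : Ordinal.{u})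
    (N : Set ZFSet.{u}) (j : ZFSet.{u} → N) : Prop :=
  (∀ x ∈ N, ∀ y ∈ x, y ∈ N) ∧
  ∃ cls : FinSupp κ.ord.ToType θ.ToType → N, Function.Surjective cls ∧
    (∀ F G, cls F = cls G ↔ AlmostAll U fun x => F.1 x = G.1 x) ∧
    (∀ F G, (cls F).1 ∈ (cls G).1 ↔ AlmostAll U fun x => F.1 x ∈ G.1 x) ∧
    ∀ a, j a = cls (FinSupp.const a)

/-- The ordinal `κ` is the critical point of `j`: the least ordinal moved by `j`. -/
def IsCriticalPoint {N : Set ZFSet.{u}} (j : ZFSet.{u} → N) (κ : Ordinal.{u}) : Prop :=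
  (j κ.toZFSet : ZFSet.{u}) ≠ κ.toZFSet ∧
    ∀ β < κ, (j β.toZFSet : ZFSet.{u}) = β.toZFSet

/-- The structure `(j(M), ∈, j(A))`. -/
def SetStr.image {N : Set ZFSet.{u}} (j : ZFSet.{u} → N) (M : SetStr.{u}) : SetStr.{u} :=
  ⟨j M.carrier, j M.pred⟩

end TransitiveSpectra

open TransitiveSpectra

-- The iterate is built in one step, from functions on `κ^θ` that depend on finitely many
-- coordinates, taken modulo the iterated quantifier "for `U`-almost all". On such functions this
-- quantifier commutes with the connectives, and since witnesses can be chosen without enlarging the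
-- support it also commutes with quantifiers over a structure. This gives Łoś's theorem
-- (`IsReducedPower.realize_iff`), hence elementarity of the constant-function embedding `j`.
--
-- Membership in the power is well-founded because countably many sets of full measure have a common
-- point (`exists_forall_of_almostAll`): a descending chain of classes would give a descending chain
-- of sets there. Extensionality and set-likeness then allow the Mostowski collapse onto `N`.
--
-- Completeness makes `j` fix every ordinal below `κ` (`const_toZFSet`). The `θ` coordinate
-- functions represent strictly increasing elements of `j(κ)`, so `α < θ` gives `α ∈ j(κ)`
-- (`toZFSet_mem_const_toZFSet`). If `κ ≤ α`, then `α ∈ j(κ) ⊆ j(α)`, so `j(M)` is taller than `M`.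
-- Thus `M` is not maximal, and `α` is not the greatest height of a model of any theory true in `M`.

universe v w

namespace TransitiveSpectra

/-! ### Functions that depend on finitely many coordinates -/

section FinDep

variable {K I : Type u} {X : Type v} {Y : Type w}

/-- `F` depends on finitely many coordinates. -/
def FinDep (F : (I → K) → X) : Prop :=
  ∃ s : Finset I, DependsOn F (s : Set I)

theorem FinDep.const (a : X) : FinDep (fun _ : I → K => a) :=
  ⟨∅, fun _ _ _ => rfl⟩

theorem FinDep.eval (i : I) : FinDep (fun x : I → K => x i) :=
  ⟨{i}, fun _ _ h => h i (by simp)⟩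

theorem FinDep.comp {F : (I → K) → X} (hF : FinDep F) (h : X → Y) :
    FinDep fun x => h (F x) := by
  obtain ⟨s, hs⟩ := hF
  exact ⟨s, fun x y hxy => congrArg h (hs hxy)⟩

theorem FinDep.prodMk {F : (I → K) → X} {G : (I → K) → Y} (hF : FinDep F) (hG : FinDep G) :
    FinDep fun x => (F x, G x) := by
  classical
  obtain ⟨s, hs⟩ := hF
  obtain ⟨t, ht⟩ := hG
  refine ⟨s ∪ t, fun x y hxy => Prod.ext (hs fun i hi => hxy i ?_) (ht fun i hi => hxy i ?_)⟩ <;>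
  simp_all

theorem FinDep.comp₂ {Z : Type*} {F : (I → K) → X} {G : (I → K) → Y} (hF : FinDep F)
    (hG : FinDep G) (h : X → Y → Z) : FinDep fun x => h (F x) (G x) :=
  (hF.prodMk hG).comp fun p => h p.1 p.2

theorem FinDep.pi {ι : Type*} [Finite ι] {F : ι → (I → K) → X} (hF : ∀ k, FinDep (F k)) :
    FinDep fun x k => F k x := by
  classical
  cases nonempty_fintype ι
  choose s hs using hF
  refine ⟨Finset.univ.biUnion s, fun x y hxy => funext fun k => hs k fun i hi => hxy i ?_⟩
  simpa using ⟨k, hi⟩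

end FinDep

/-- The functions `(I → K) → X` that depend on finitely many coordinates. -/
abbrev FinFun (K I : Type u) (X : Type v) : Type (max u v) :=
  {F : (I → K) → X // FinDep F}

/-- The constant function with value `a`. -/
def FinFun.const {K I : Type u} {X : Type v} (a : X) : FinFun K I X :=
  ⟨fun _ => a, FinDep.const a⟩

/-! ### The iterated quantifier -/

section IteratedForall

variable {K I : Type u} [DecidableEq I] {U : Ultrafilter K} {P Q : (I → K) → Prop}

theorem iteratedForall_mono (h : ∀ x, P x → Q x) (l : List I) (x : I → K)
    (hP : iteratedForall U l P x) : iteratedForall U l Q x := by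
  induction l generalizing x with
  | nil => exact h x hP
  | cons i l ih => exact Filter.Eventually.mono hP fun ξ hξ => ih _ hξ

theorem iteratedForall_and (l : List I) (x : I → K) :
    iteratedForall U l (fun x => P x ∧ Q x) x ↔
      iteratedForall U l P x ∧ iteratedForall U l Q x := by
  induction l generalizing x with
  | nil => exact Iff.rfl
  | cons i l ih => simp only [iteratedForall, ih, Filter.eventually_and]

theorem iteratedForall_not (l : List I) (x : I → K) :
    iteratedForall U l (fun x => ¬ P x) x ↔ ¬ iteratedForall U l P x := by
  induction l generalizing x with
  | nil => exact Iff.rfl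
  | cons i l ih => simp only [iteratedForall, ih, Ultrafilter.eventually_not]

theorem exists_of_iteratedForall (l : List I) (x : I → K) (h : iteratedForall U l P x) :
    ∃ y, P y := by
  induction l generalizing x with
  | nil => exact ⟨x, h⟩
  | cons i l ih =>
    obtain ⟨ξ, hξ⟩ := Filter.Eventually.exists h
    exact ih _ hξ

theorem dependsOn_iteratedForall {s : Set I} (hP : DependsOn P s) (l : List I) :
    DependsOn (iteratedForall U l P) {i | i ∈ s ∧ i ∉ l} := by
  induction l with
  | nil => exact hP.mono fun i hi => by simpa using hi
  | cons i l ih =>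
    intro x y hxy
    refine congrArg (fun p : K → Prop => ∀ᶠ ξ in (U : Filter K), p ξ) (funext fun ξ => ih ?_)
    intro j hj
    by_cases hji : j = i
    · subst hji; simp
    · simpa [hji] using hxy j ⟨hj.1, by simp [hji, hj.2]⟩

/-- A quantifier over a coordinate outside the support is vacuous, `U` being a proper filter. -/
theorem iteratedForall_filter {s : Finset I} (hP : DependsOn P (s : Set I)) (l : List I)
    (x : I → K) :
    iteratedForall U (l.filter (· ∈ s)) P x ↔ iteratedForall U l P x := by
  induction l generalizing x with
  | nil => exact Iff.rfl
  | cons i l ih =>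
    by_cases hi : i ∈ s
    · rw [List.filter_cons_of_pos (by simpa using hi)]
      simp only [iteratedForall, ih]
    · rw [List.filter_cons_of_neg (by simpa using hi), ih]
      have : ∀ ξ, iteratedForall U l P (Function.update x i ξ) = iteratedForall U l P x := by
        intro ξ
        refine dependsOn_iteratedForall hP l fun j hj => ?_
        rw [Function.update_of_ne]
        rintro rfl
        exact hi hj.1
      simp only [iteratedForall, this, Filter.eventually_const]

end IteratedForall

theorem nonempty_fun (K I : Type u) (U : Ultrafilter K) : Nonempty (I → K) :=
  ⟨fun _ => U.neBot.nonempty.some⟩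

/-! ### The quantifier "almost all" and its logical laws -/

section AlmostAll

variable {K I : Type u} [LinearOrder I] {U : Ultrafilter K} {P Q : (I → K) → Prop}
  {X : Type v} {Y : Type w}

theorem AlmostAll.finDep (h : AlmostAll U P) : FinDep P :=
  h.imp fun _ hs => hs.1

theorem sort_filter_mem (s t : Finset I) : s.sort.filter (· ∈ t) = (s ∩ t).sort := by
  refine List.Perm.eq_of_pairwise (le := (· ≤ ·)) (fun _ _ _ _ => le_antisymm)
    ((Finset.pairwise_sort _ _).filter _) (Finset.pairwise_sort _ _) ?_
  rw [List.perm_ext_iff_of_nodup ((Finset.sort_nodup _ _).filter _) (Finset.sort_nodup _ _)]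
  simp

/-- Neither the support nor the base point matters: for supports `s` and `t`, both sorted lists
reduce to that of `s ∩ t`, and once all of `s` is quantified no coordinate is free. -/
theorem almostAll_iff {s : Finset I} (hP : DependsOn P (s : Set I)) (x : I → K) :
    AlmostAll U P ↔ iteratedForall U s.sort P x := by
  constructor
  · rintro ⟨t, ht, h⟩
    have := h x
    rwa [← iteratedForall_filter hP, sort_filter_mem, Finset.inter_comm, ← sort_filter_mem,
      iteratedForall_filter ht] at this
  · refine fun h => ⟨s, hP, fun y => ?_⟩
    have : iteratedForall U s.sort P y = iteratedForall U s.sort P x :=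
      dependsOn_iteratedForall hP _ fun i hi => absurd ((Finset.mem_sort _).2 hi.1) hi.2
    rwa [this]

theorem almostAll_not (hP : FinDep P) : AlmostAll U (fun x => ¬ P x) ↔ ¬ AlmostAll U P := by
  obtain ⟨x⟩ := nonempty_fun K I U
  obtain ⟨s, hs⟩ := hP
  have hs' : DependsOn (fun x => ¬ P x) (s : Set I) := fun y z h => congrArg Not (hs h)
  rw [almostAll_iff hs x, almostAll_iff hs' x, iteratedForall_not]

theorem AlmostAll.mono (h : AlmostAll U P) (hQ : FinDep Q) (hPQ : ∀ x, P x → Q x) :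
    AlmostAll U Q := by
  obtain ⟨x⟩ := nonempty_fun K I U
  obtain ⟨s, hs⟩ := h.finDep
  obtain ⟨t, ht⟩ := hQ
  have hs' : DependsOn P ((s ∪ t : Finset I) : Set I) := hs.mono (by simp)
  have ht' : DependsOn Q ((s ∪ t : Finset I) : Set I) := ht.mono (by simp)
  rw [almostAll_iff hs' x] at h
  rw [almostAll_iff ht' x]
  exact iteratedForall_mono hPQ _ _ h

theorem AlmostAll.and (hP : AlmostAll U P) (hQ : AlmostAll U Q) :
    AlmostAll U fun x => P x ∧ Q x := by
  obtain ⟨x⟩ := nonempty_fun K I U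
  obtain ⟨s, hs⟩ := hP.finDep
  obtain ⟨t, ht⟩ := hQ.finDep
  have hs' : DependsOn P ((s ∪ t : Finset I) : Set I) := hs.mono (by simp)
  have ht' : DependsOn Q ((s ∪ t : Finset I) : Set I) := ht.mono (by simp)
  have hst : DependsOn (fun x => P x ∧ Q x) ((s ∪ t : Finset I) : Set I) :=
    fun y z h => congrArg₂ And (hs' h) (ht' h)
  rw [almostAll_iff hs' x] at hP
  rw [almostAll_iff ht' x] at hQ
  rw [almostAll_iff hst x, iteratedForall_and]
  exact ⟨hP, hQ⟩

theorem AlmostAll.mono₂ {R : (I → K) → Prop} (hP : AlmostAll U P) (hQ : AlmostAll U Q)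
    (hR : FinDep R) (h : ∀ x, P x → Q x → R x) : AlmostAll U R :=
  (hP.and hQ).mono hR fun x hx => h x hx.1 hx.2

theorem AlmostAll.exists (h : AlmostAll U P) : ∃ x, P x := by
  obtain ⟨x⟩ := nonempty_fun K I U
  obtain ⟨s, -, hs⟩ := h
  exact exists_of_iteratedForall _ _ (hs x)

theorem almostAll_of_forall (h : ∀ x, P x) : AlmostAll U P :=
  ⟨∅, fun x y _ => by simp [h], fun x => by simpa [iteratedForall] using h x⟩

theorem almostAll_const {p : Prop} : AlmostAll U (fun _ : I → K => p) ↔ p :=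
  ⟨fun h => h.exists.elim fun _ hp => hp, fun h => almostAll_of_forall fun _ => h⟩

theorem almostAll_imp (hP : FinDep P) (hQ : FinDep Q) :
    AlmostAll U (fun x => P x → Q x) ↔ (AlmostAll U P → AlmostAll U Q) := by
  have hPQ : FinDep fun x => P x → Q x := hP.comp₂ hQ fun p q => p → q
  refine ⟨fun h h' => h.mono₂ h' hQ fun x h₁ h₂ => h₁ h₂, fun h => ?_⟩
  by_cases h' : AlmostAll U P
  · exact (h h').mono hPQ fun x hx _ => hx
  · exact ((almostAll_not hP).2 h').mono hPQ fun x hx hx' => absurd hx' hx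

/-- The witness is chosen as a function of the value `F.1 x`, so it depends on no coordinates beyond
those of `F`. -/
theorem almostAll_exists (F : FinFun K I X) (R : X → Y → Prop) :
    AlmostAll U (fun x => ∃ y, R (F.1 x) y) ↔
      ∃ G : FinFun K I Y, AlmostAll U fun x => R (F.1 x) (G.1 x) := by
  classical
  constructor
  · intro h
    obtain ⟨x, y₀, -⟩ := h.exists
    refine ⟨⟨_, F.2.comp fun a => if h : ∃ y, R a y then h.choose else y₀⟩, h.mono ?_ ?_⟩
    · exact F.2.comp fun a => R a (if h : ∃ y, R a y then h.choose else y₀)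
    · intro x hx
      simpa only [dif_pos hx] using hx.choose_spec
  · rintro ⟨G, hG⟩
    exact hG.mono (F.2.comp fun a => ∃ y, R a y) fun x hx => ⟨_, hx⟩

theorem almostAll_forall (F : FinFun K I X) (R : X → Y → Prop) :
    AlmostAll U (fun x => ∀ y, R (F.1 x) y) ↔
      ∀ G : FinFun K I Y, AlmostAll U fun x => R (F.1 x) (G.1 x) := by
  have h := almostAll_exists (U := U) F fun a y => ¬ R a y
  simp only [← not_forall] at h
  rw [almostAll_not (F.2.comp fun a => ∀ y, R a y), not_iff_comm] at h
  rw [← h, not_exists]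
  refine forall_congr' fun G => ?_
  rw [almostAll_not (F.2.comp₂ G.2 R), not_not]

theorem almostAll_lt [Preorder K] (hU : ∀ k, ∀ᶠ ξ in (U : Filter K), k < ξ) {i j : I}
    (hij : i < j) : AlmostAll U fun x => x i < x j := by
  have hs : ({i, j} : Finset I).sort = [i, j] := by
    rw [Finset.sort_insert, Finset.sort_singleton]
    · simpa using hij.le
    · simpa using hij.ne
  refine ⟨{i, j}, fun x y h => ?_, fun x => ?_⟩
  · change (x i < x j) = (y i < y j)
    rw [h i (by simp), h j (by simp)]
  -- The larger index is quantified innermost, so `x i` is already fixed when `x j` is chosen above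
  -- it.
  · simp [hs, iteratedForall, hij.ne, hU]

/-- A function with fewer than `c` values is almost everywhere constant, if `U` is
`c`-complete. -/
theorem exists_almostAll_eq {c : Cardinal.{u}} [CardinalInterFilter (U : Filter K) c] {B : Type u}
    (hB : #B < c) (F : FinFun K I B) : ∃ b, AlmostAll U fun x => F.1 x = b := by
  have key : ∀ (l : List I) (x : I → K), ∃ b, iteratedForall U l (fun x => F.1 x = b) x := by
    intro l
    induction l with
    | nil => exact fun x => ⟨F.1 x, rfl⟩
    | cons i l ih =>
      intro x
      choose b hb using fun ξ => ih (Function.update x i ξ)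
      -- Otherwise the fewer than `c` sets `{ξ | b ξ ≠ b₀}` would have a common point.
      obtain ⟨b₀, hb₀⟩ : ∃ b₀, ∀ᶠ ξ in (U : Filter K), b ξ = b₀ := by
        by_contra h
        have h' : ∀ b₀, ∀ᶠ ξ in (U : Filter K), ¬ b ξ = b₀ :=
          fun b₀ => Ultrafilter.eventually_not.2 fun hb₀ => h ⟨b₀, hb₀⟩
        obtain ⟨ξ, hξ⟩ := ((Filter.eventually_cardinal_forall hB).2 h').exists
        exact hξ _ rfl
      exact ⟨b₀, hb₀.mono fun ξ hξ => hξ ▸ hb ξ⟩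
  obtain ⟨x⟩ := nonempty_fun K I U
  obtain ⟨s, hs⟩ := F.2
  obtain ⟨b, hb⟩ := key s.sort x
  refine ⟨b, (almostAll_iff (fun y z h => ?_) x).2 hb⟩
  exact congrArg (· = b) (hs h)

/-- Countably many sets of full measure have a common point, if `U` is countably complete. -/
theorem exists_forall_of_almostAll [WellFoundedLT I] [CountableInterFilter (U : Filter K)]
    {P : ℕ → (I → K) → Prop} (h : ∀ n, AlmostAll U (P n)) : ∃ x, ∀ n, P n x := by
  classical
  choose s hs hP using h
  let L (n k : ℕ) : List I := (s n).sort.drop k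
  obtain ⟨x₀⟩ := nonempty_fun K I U
  -- Each implication holds for almost all `ξ`, vacuously if its premise fails, and there are only
  -- countably many pairs `(n, k)`.
  have step : ∀ (i : I) (z : I → K), ∃ ξ, ∀ n k,
      (∀ᶠ ξ' in (U : Filter K), iteratedForall U (L n k) (P n) (Function.update z i ξ')) →
      iteratedForall U (L n k) (P n) (Function.update z i ξ) := by
    intro i z
    refine Filter.Eventually.exists (f := (U : Filter K)) ?_
    refine eventually_countable_forall.2 fun n => eventually_countable_forall.2 fun k => ?_
    by_cases h : ∀ᶠ ξ' in (U : Filter K),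
        iteratedForall U (L n k) (P n) (Function.update z i ξ')
    · exact h.mono fun ξ hξ _ => hξ
    · exact Filter.Eventually.of_forall fun ξ h' => absurd h' h
  choose g hg using step
  -- The point is built by recursion along `I`. Coordinates not yet chosen get the filler `x₀`,
  -- which `hdep` shows to be harmless.
  let ext (i : I) (f : ∀ j, j < i → K) : I → K := fun j => if h : j < i then f j h else x₀ j
  let x : I → K := wellFounded_lt.fix fun i f => g i (ext i f)
  have hx : ∀ i, x i = g i (ext i fun j _ => x j) := fun i => wellFounded_lt.fix_eq _ i
  have main : ∀ n k, k ≤ (s n).sort.length → iteratedForall U (L n k) (P n) x := by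
    intro n k
    induction k with
    | zero => exact fun _ => hP n x
    | succ k ih =>
      intro hk
      have hk' : k < (s n).sort.length := hk
      set i := (s n).sort[k] with hi
      have hL : L n k = i :: L n (k + 1) := List.drop_eq_getElem_cons hk'
      have hle : ∀ j ∈ s n, j ∉ L n (k + 1) → j ≤ i := by
        intro j hj hj'
        obtain ⟨m, hm, rfl⟩ := List.getElem_of_mem ((Finset.mem_sort (· ≤ ·)).2 hj)
        rcases le_or_gt m k with hmk | hmk
        · rcases hmk.eq_or_lt with rfl | hmk
          · exact le_rfl
          · exact List.pairwise_iff_getElem.1 (Finset.pairwise_sort (s n) (· ≤ ·)) m k hm hk' hmk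
        · exact absurd (List.mem_drop_iff_getElem.2 ⟨m - (k + 1), by omega, by
            congr 1; omega⟩) hj'
      -- The lists are sorted, so with `L n (k + 1)` quantified away only coordinates up to `i` are
      -- free.
      have hdep : ∀ ξ, iteratedForall U (L n (k + 1)) (P n) (Function.update x i ξ) =
          iteratedForall U (L n (k + 1)) (P n)
            (Function.update (ext i fun j _ => x j) i ξ) := by
        intro ξ
        refine dependsOn_iteratedForall (hs n) _ fun j hj => ?_
        rcases (hle j hj.1 hj.2).eq_or_lt with rfl | hlt
        · simp
        · simp [hlt.ne, ext, hlt]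
      have h₁ := ih hk'.le
      rw [hL] at h₁
      simp only [iteratedForall, hdep] at h₁
      have h₂ := hg i _ n (k + 1) h₁
      rw [← hx i, ← hdep, Function.update_eq_self] at h₂
      exact h₂
  refine ⟨x, fun n => ?_⟩
  have h := main n _ le_rfl
  simp only [L, List.drop_length] at h
  exact h

end AlmostAll

/-! ### Łoś's theorem -/

section Los

variable {K I : Type u} [LinearOrder I] {U : Ultrafilter K} {X : Type v} {Y : Type w}
  {L : FirstOrder.Language.{0, 0}} [L.IsRelational] [L.Structure X] [L.Structure Y]

/-- `Y`, with `c : FinFun K I X → Y`, is the structure of all finitely dependent functions with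
values in the structure `X`, modulo almost everywhere equality. -/
structure IsReducedPower (U : Ultrafilter K) (L : FirstOrder.Language.{0, 0}) [L.Structure X]
    [L.Structure Y] (c : FinFun K I X → Y) : Prop where
  surjective : Function.Surjective c
  eq_iff : ∀ F G, c F = c G ↔ AlmostAll U fun x => F.1 x = G.1 x
  relMap_iff : ∀ {n} (R : L.Relations n) (F : Fin n → FinFun K I X),
    FirstOrder.Language.Structure.RelMap R (fun k => c (F k)) ↔
      AlmostAll U fun x => FirstOrder.Language.Structure.RelMap R fun k => (F k).1 x

namespace IsReducedPower

variable {c : FinFun K I X → Y}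

theorem realize_iff (hc : IsReducedPower U L c) {α : Type*} [Finite α] {n : ℕ}
    (φ : L.BoundedFormula α n) (v : α → FinFun K I X) (w : Fin n → FinFun K I X) :
    φ.Realize (fun a => c (v a)) (fun k => c (w k)) ↔
      AlmostAll U fun x => φ.Realize (fun a => (v a).1 x) fun k => (w k).1 x := by
  have fin {n : ℕ} (w : Fin n → FinFun K I X) :
      FinDep fun x => ((fun a => (v a).1 x, fun k => (w k).1 x) : (α → X) × (Fin n → X)) :=
    (FinDep.pi fun a => (v a).2).prodMk (FinDep.pi fun k => (w k).2)
  have term {n : ℕ} (t : L.Term (α ⊕ Fin n)) (w : Fin n → FinFun K I X) :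
      ∃ F : FinFun K I X, t.realize (Sum.elim (fun a => c (v a)) fun k => c (w k)) = c F ∧
        ∀ x, t.realize (Sum.elim (fun a => (v a).1 x) fun k => (w k).1 x) = F.1 x := by
    rcases t with (a | k) | ⟨f, -⟩
    · exact ⟨v a, rfl, fun _ => rfl⟩
    · exact ⟨w k, rfl, fun _ => rfl⟩
    · exact isEmptyElim f
  induction φ with
  | falsum => exact (almostAll_const (p := False)).symm
  | equal t₁ t₂ =>
    obtain ⟨F, hF, hF'⟩ := term t₁ w
    obtain ⟨G, hG, hG'⟩ := term t₂ w
    simp only [FirstOrder.Language.BoundedFormula.Realize, hF, hG, hF', hG', hc.eq_iff]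
  | rel R ts =>
    choose F hF hF' using fun k => term (ts k) w
    simp only [FirstOrder.Language.BoundedFormula.Realize, hF, hF', hc.relMap_iff]
  | imp φ ψ ihφ ihψ =>
    simp only [FirstOrder.Language.BoundedFormula.realize_imp, ihφ, ihψ]
    exact (almostAll_imp ((fin w).comp fun p => φ.Realize p.1 p.2)
      ((fin w).comp fun p => ψ.Realize p.1 p.2)).symm
  | all φ ih =>
    simp only [FirstOrder.Language.BoundedFormula.realize_all]
    rw [almostAll_forall ⟨_, fin w⟩ fun p y => φ.Realize p.1 (Fin.snoc p.2 y),
      hc.surjective.forall]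
    refine forall_congr' fun G => ?_
    have h := ih (Fin.snoc w G)
    have h₁ : (fun k => c ((Fin.snoc w G : Fin _ → FinFun K I X) k)) =
        Fin.snoc (fun k => c (w k)) (c G) := Fin.comp_snoc c w G
    have h₂ : ∀ x, (fun k => ((Fin.snoc w G : Fin _ → FinFun K I X) k).1 x) =
        Fin.snoc (fun k => (w k).1 x) (G.1 x) :=
      fun x => Fin.comp_snoc (fun F : FinFun K I X => F.1 x) w G
    simpa only [h₁, h₂] using h

/-- The canonical elementary embedding of a structure into its reduced power. -/
def elementaryEmbedding (hc : IsReducedPower U L c) : X ↪ₑ[L] Y where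
  toFun a := c (FinFun.const a)
  map_formula' n φ x := by
    have h := hc.realize_iff φ (fun a => FinFun.const (x a)) Fin.elim0
    have h₀ : ∀ y : I → K, (fun k : Fin 0 => (Fin.elim0 k : FinFun K I X).1 y) = default :=
      fun _ => Subsingleton.elim _ _
    have h₁ : (fun k : Fin 0 => c (Fin.elim0 k)) = default := Subsingleton.elim _ _
    simp only [h₀, h₁] at h
    exact h.trans (almostAll_const (p := φ.Realize x))

end IsReducedPower

end Los

/-! ### The Mostowski collapse -/

theorem exists_collapse {Q : Type v} {r : Q → Q → Prop} (wf : WellFounded r)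
    (hext : ∀ a b, (∀ c, r c a ↔ r c b) → a = b) (hsmall : ∀ a, Small.{u} {b // r b a}) :
    ∃ π : Q → ZFSet.{u}, Function.Injective π ∧ ∀ a y, y ∈ π a ↔ ∃ b, r b a ∧ π b = y := by
  let π : Q → ZFSet.{u} := wf.fix fun a f => ZFSet.range fun b : {b // r b a} => f b.1 b.2
  have hπ : ∀ a y, y ∈ π a ↔ ∃ b, r b a ∧ π b = y := by
    intro a y
    have : π a = ZFSet.range fun b : {b // r b a} => π b.1 := wf.fix_eq _ a
    simp [this]
  refine ⟨π, fun a => ?_, hπ⟩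
  induction a using wf.induction with
  | _ a ih =>
    intro b hab
    refine hext a b fun c => ⟨fun hc => ?_, fun hc => ?_⟩
    · obtain ⟨d, hd, hdc⟩ := (hπ b _).1 (hab ▸ (hπ a _).2 ⟨c, hc, rfl⟩)
      rwa [ih c hc hdc.symm]
    · obtain ⟨d, hd, hdc⟩ := (hπ a _).1 (hab ▸ (hπ b _).2 ⟨c, hc, rfl⟩)
      rwa [← ih d hd hdc]

/-! ### The iterated ultrapower -/

section IteratedPower

variable {K I : Type u} [LinearOrder I] {U : Ultrafilter K}

/-- `N` is the transitive collapse of the class of all finitely dependent functions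
`(I → K) → V`, where `cls F` is the element of `N` represented by `F`. -/
structure IsIteratedPower (U : Ultrafilter K) (N : Set ZFSet.{u})
    (cls : FinFun K I ZFSet.{u} → N) : Prop where
  mem_of_mem : ∀ x ∈ N, ∀ y ∈ x, y ∈ N
  surjective : Function.Surjective cls
  eq_iff : ∀ F G, cls F = cls G ↔ AlmostAll U fun x => F.1 x = G.1 x
  mem_iff : ∀ F G, (cls F).1 ∈ (cls G).1 ↔ AlmostAll U fun x => F.1 x ∈ G.1 x

/-- A descending chain, evaluated at a common point of its countably many membership conditions,
descends in `∈`. -/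
theorem wellFounded_almostAll_mem [WellFoundedLT I] [CountableInterFilter (U : Filter K)] :
    WellFounded fun F G : FinFun K I ZFSet.{u} => AlmostAll U fun x => F.1 x ∈ G.1 x := by
  refine wellFounded_iff_isEmpty_descending_chain.2 ⟨fun ⟨f, hf⟩ => ?_⟩
  obtain ⟨x, hx⟩ := exists_forall_of_almostAll hf
  exact (wellFounded_iff_isEmpty_descending_chain.1 ZFSet.mem_wf).false ⟨fun n => (f n).1 x, hx⟩

variable (I) in
/-- Almost everywhere equality of finitely dependent functions. -/
def almostEqSetoid (U : Ultrafilter K) : Setoid (FinFun K I ZFSet.{u}) where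
  r F G := AlmostAll U fun x => F.1 x = G.1 x
  iseqv :=
    { refl := fun _ => almostAll_of_forall fun _ => rfl
      symm := fun {F G} h => h.mono (G.2.comp₂ F.2 Eq) fun _ => Eq.symm
      trans := fun {F _ H} h h' => h.mono₂ h' (F.2.comp₂ H.2 Eq) fun _ => Eq.trans }

theorem almostAll_mem_congr {F F' G G' : FinFun K I ZFSet.{u}}
    (hF : AlmostAll U fun x => F.1 x = F'.1 x) (hG : AlmostAll U fun x => G.1 x = G'.1 x) :
    (AlmostAll U fun x => F.1 x ∈ G.1 x) ↔ AlmostAll U fun x => F'.1 x ∈ G'.1 x := by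
  constructor <;> intro h
  · exact (hF.and hG).mono₂ h (F'.2.comp₂ G'.2 (· ∈ ·)) fun x e m => e.1 ▸ e.2 ▸ m
  · exact (hF.and hG).mono₂ h (F.2.comp₂ G.2 (· ∈ ·)) fun x e m => by rwa [e.1, e.2]

theorem almostAll_subset_iff (F G : FinFun K I ZFSet.{u}) :
    (AlmostAll U fun x => F.1 x ⊆ G.1 x) ↔ ∀ H : FinFun K I ZFSet.{u},
      (AlmostAll U fun x => H.1 x ∈ F.1 x) → AlmostAll U fun x => H.1 x ∈ G.1 x := by
  refine (almostAll_forall ⟨_, F.2.prodMk G.2⟩ fun p y => y ∈ p.1 → y ∈ p.2).trans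
    (forall_congr' fun H => ?_)
  exact almostAll_imp (H.2.comp₂ F.2 (· ∈ ·)) (H.2.comp₂ G.2 (· ∈ ·))

theorem exists_isIteratedPower [WellFoundedLT I] [CountableInterFilter (U : Filter K)] :
    ∃ (N : Set ZFSet.{u}) (cls : FinFun K I ZFSet.{u} → N), IsIteratedPower U N cls := by
  classical
  let Q := Quotient (almostEqSetoid I U)
  let r : Q → Q → Prop := Quotient.lift₂ (fun F G => AlmostAll U fun x => F.1 x ∈ G.1 x)
    fun _ _ _ _ h h' => propext (almostAll_mem_congr h h')
  have wf : WellFounded r :=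
    wellFounded_lift₂_iff.2 wellFounded_almostAll_mem
  have hext : ∀ a b : Q, (∀ c, r c a ↔ r c b) → a = b := by
    intro a b
    induction a, b using Quotient.inductionOn₂ with
    | _ F G =>
      intro h
      have h₁ := (almostAll_subset_iff F G).2 fun H => (h ⟦H⟧).1
      have h₂ := (almostAll_subset_iff G F).2 fun H => (h ⟦H⟧).2
      exact Quotient.sound (h₁.mono₂ h₂ (F.2.comp₂ G.2 Eq) fun x h h' =>
        ZFSet.ext fun z => ⟨@h z, @h' z⟩)
  have hsmall : ∀ a : Q, Small.{u} {b // r b a} := by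
    intro a
    induction a using Quotient.inductionOn with
    | _ F =>
      -- Every member of the class of `F` has a representative with values in the set `B`; `∅`
      -- serves as default where `G.1 x ∉ F.1 x`.
      let B : ZFSet.{u} := insert ∅ (ZFSet.iUnion fun x : I → K => F.1 x)
      let C := {f : (I → K) → {y // y ∈ B} // FinDep f}
      have : Small.{u} {y // y ∈ B} := inferInstance
      let g : C → Q := fun f => ⟦⟨fun x => (f.1 x).1, f.2.comp Subtype.val⟩⟧
      have hg : {b | r b ⟦F⟧} ⊆ Set.range g := by
        intro b
        induction b using Quotient.inductionOn with
        | _ G =>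
          intro h
          let G' : (I → K) → {y // y ∈ B} := fun x =>
            if h : G.1 x ∈ F.1 x then ⟨G.1 x, by
              simp only [B, ZFSet.mem_insert_iff, ZFSet.mem_iUnion]; exact .inr ⟨x, h⟩⟩
            else ⟨∅, by simp [B]⟩
          have hG' : ∀ x, (G' x).1 = if G.1 x ∈ F.1 x then G.1 x else ∅ := by
            intro x
            by_cases h : G.1 x ∈ F.1 x <;> simp [G', h]
          have hfin : FinDep G' := by
            obtain ⟨s, hs⟩ := G.2.comp₂ F.2 fun a b => if a ∈ b then a else ∅
            exact ⟨s, fun x y hxy => Subtype.ext (by rw [hG', hG']; exact hs hxy)⟩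
          refine ⟨⟨G', hfin⟩, Quotient.sound ?_⟩
          refine AlmostAll.mono (P := fun x => G.1 x ∈ F.1 x) h
            ((hfin.comp Subtype.val).comp₂ G.2 Eq) fun x hx => ?_
          simp [hG', hx]
      exact small_subset hg
  obtain ⟨π, hinj, hπ⟩ := exists_collapse.{u} wf hext hsmall
  refine ⟨Set.range π, fun F => ⟨π ⟦F⟧, ⟦F⟧, rfl⟩, ?_, ?_, ?_, ?_⟩
  · rintro _ ⟨a, rfl⟩ y hy
    obtain ⟨b, -, rfl⟩ := (hπ a y).1 hy
    exact ⟨b, rfl⟩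
  · rintro ⟨_, a, rfl⟩
    induction a using Quotient.inductionOn with
    | _ F => exact ⟨F, rfl⟩
  · intro F G
    exact (Subtype.ext_iff.trans hinj.eq_iff).trans Quotient.eq
  · intro F G
    rw [hπ]
    constructor
    · rintro ⟨b, hb, hbF⟩
      rwa [hinj hbF] at hb
    · exact fun h => ⟨⟦F⟧, h, rfl⟩

end IteratedPower

instance : memLang.IsRelational := fun _ => inferInstanceAs (IsEmpty Empty)

instance : memPredLang.IsRelational := fun _ => inferInstanceAs (IsEmpty Empty)

/-! ### Absoluteness, ordinals and set structures in the iterate -/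

namespace IsIteratedPower

variable {K I : Type u} [LinearOrder I] {U : Ultrafilter K} {N : Set ZFSet.{u}}
  {cls : FinFun K I ZFSet.{u} → N}

theorem isReducedPower (h : IsIteratedPower U N cls) : IsReducedPower U memLang cls where
  surjective := h.surjective
  eq_iff := h.eq_iff
  relMap_iff := fun {n} (R : MemRel n) F => match n, R, F with
    | _, MemRel.mem, F => h.mem_iff (F 0) (F 1)

theorem exists_of_mem (h : IsIteratedPower U N cls) {F : FinFun K I ZFSet.{u}} {y : ZFSet.{u}}
    (hy : y ∈ (cls F).1) :
    ∃ G : FinFun K I ZFSet.{u}, (cls G).1 = y ∧ AlmostAll U fun x => G.1 x ∈ F.1 x := by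
  obtain ⟨G, hG⟩ := h.surjective ⟨y, h.mem_of_mem _ (cls F).2 y hy⟩
  have hG' : (cls G).1 = y := congrArg Subtype.val hG
  exact ⟨G, hG', (h.mem_iff G F).1 (by rwa [hG'])⟩

/-- The bounded-quantifier case of Łoś's theorem, with `p` evaluated in `V`: transitivity of `N`
ensures that every member of a class is represented. -/
theorem forall_mem_iff (h : IsIteratedPower U N cls) {p q : ZFSet.{u} → Prop}
    (hpq : ∀ G, p (cls G).1 ↔ AlmostAll U fun x => q (G.1 x)) (F : FinFun K I ZFSet.{u}) :
    (∀ y ∈ (cls F).1, p y) ↔ AlmostAll U fun x => ∀ y ∈ F.1 x, q y := by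
  rw [almostAll_forall F fun a y => y ∈ a → q y]
  constructor
  · intro h' G
    rw [almostAll_imp (G.2.comp₂ F.2 (· ∈ ·)) (G.2.comp q), ← h.mem_iff, ← hpq]
    exact h' _
  · intro h' y hy
    obtain ⟨G, rfl, hG⟩ := h.exists_of_mem hy
    rw [hpq]
    exact (almostAll_imp (G.2.comp₂ F.2 (· ∈ ·)) (G.2.comp q)).1 (h' G) hG

theorem subset_iff (h : IsIteratedPower U N cls) (F G : FinFun K I ZFSet.{u}) :
    (cls F).1 ⊆ (cls G).1 ↔ AlmostAll U fun x => F.1 x ⊆ G.1 x := by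
  rw [almostAll_subset_iff]
  constructor
  · intro hs H
    rw [← h.mem_iff, ← h.mem_iff]
    exact @hs _
  · intro hs y hy
    obtain ⟨H, rfl, hH⟩ := h.exists_of_mem hy
    exact (h.mem_iff _ _).2 (hs H hH)

theorem isTransitive_iff (h : IsIteratedPower U N cls) (F : FinFun K I ZFSet.{u}) :
    (cls F).1.IsTransitive ↔ AlmostAll U fun x => (F.1 x).IsTransitive := by
  have e := almostAll_forall (U := U) F fun a y => y ∈ a → y ⊆ a
  refine Iff.trans ?_ e.symm
  constructor
  · intro h' G
    rw [almostAll_imp (G.2.comp₂ F.2 (· ∈ ·)) (G.2.comp₂ F.2 (· ⊆ ·)), ← h.mem_iff,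
      ← h.subset_iff]
    exact h' _
  · intro h' y hy
    obtain ⟨G, rfl, hG⟩ := h.exists_of_mem hy
    rw [h.subset_iff]
    exact (almostAll_imp (G.2.comp₂ F.2 (· ∈ ·)) (G.2.comp₂ F.2 (· ⊆ ·))).1 (h' G) hG

theorem isOrdinal_iff (h : IsIteratedPower U N cls) (F : FinFun K I ZFSet.{u}) :
    (cls F).1.IsOrdinal ↔ AlmostAll U fun x => (F.1 x).IsOrdinal := by
  simp only [ZFSet.isOrdinal_iff_forall_mem_isTransitive]
  rw [h.isTransitive_iff, h.forall_mem_iff h.isTransitive_iff]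
  exact ⟨fun h' => h'.1.and h'.2, fun h' =>
    ⟨h'.mono (F.2.comp _) fun _ => And.left,
      h'.mono (F.2.comp fun a => ∀ y ∈ a, y.IsTransitive) fun _ => And.right⟩⟩

theorem const_mem_const (h : IsIteratedPower U N cls) {a b : ZFSet.{u}} :
    (cls (FinFun.const a)).1 ∈ (cls (FinFun.const b)).1 ↔ a ∈ b :=
  (h.mem_iff _ _).trans (almostAll_const (p := a ∈ b))

theorem const_subset_const (h : IsIteratedPower U N cls) {a b : ZFSet.{u}} :
    (cls (FinFun.const a)).1 ⊆ (cls (FinFun.const b)).1 ↔ a ⊆ b :=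
  (h.subset_iff _ _).trans (almostAll_const (p := a ⊆ b))

/-- The embedding fixes all ordinals below the completeness of the ultrafilter. -/
theorem const_toZFSet (h : IsIteratedPower U N cls) {κ : Cardinal.{u}}
    [CardinalInterFilter (U : Filter K) κ] {β : Ordinal.{u}} (hβ : β < κ.ord) :
    (cls (FinFun.const β.toZFSet)).1 = β.toZFSet := by
  induction β using WellFoundedLT.induction with
  | _ β ih =>
    ext y
    constructor
    · intro hy
      obtain ⟨G, rfl, hG⟩ := h.exists_of_mem hy
      have hcard : #β.ToType < κ := by rwa [Cardinal.mk_toType, ← lt_ord]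
      have hβ₀ : 0 < β := by
        obtain ⟨x, hx⟩ := hG.exists
        obtain ⟨a, ha, -⟩ := Ordinal.mem_toZFSet_iff.1 hx
        exact pos_of_gt ha
      -- `G` takes values in `β` almost everywhere, so its rank is almost everywhere a constant `γ <
      -- β`. The default `0` off `β` is why `hβ₀` is needed.
      obtain ⟨b, hb⟩ := exists_almostAll_eq (U := U) hcard ⟨_, G.2.comp fun a =>
        Ordinal.ToType.mk (if h : a.rank < β then ⟨a.rank, h⟩ else ⟨0, hβ₀⟩)⟩
      obtain ⟨γ, rfl⟩ := Ordinal.ToType.mk.surjective b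
      have hγ : cls G = cls (FinFun.const γ.1.toZFSet) := by
        refine (h.eq_iff _ _).2 (hG.mono₂ hb (G.2.comp (· = γ.1.toZFSet)) fun x hx hx' => ?_)
        obtain ⟨δ, hδ, hδx⟩ := Ordinal.mem_toZFSet_iff.1 hx
        replace hx' := Ordinal.ToType.mk.injective hx'
        rw [← hδx] at hx' ⊢
        simp only [Ordinal.rank_toZFSet, dif_pos hδ] at hx'
        rw [← hx']
        rfl
      rw [hγ, ih γ.1 γ.2 (lt_trans γ.2 hβ)]
      exact Ordinal.toZFSet_mem_toZFSet_iff.2 γ.2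
    · intro hy
      obtain ⟨γ, hγ, rfl⟩ := Ordinal.mem_toZFSet_iff.1 hy
      rw [← ih γ hγ (hγ.trans hβ), h.const_mem_const]
      exact hy

/-- The coordinate functions represent an increasing sequence of elements of `j(κ)`. -/
theorem toZFSet_mem_const_toZFSet {o θ α : Ordinal.{u}} {U : Ultrafilter o.ToType}
    {cls : FinFun o.ToType θ.ToType ZFSet.{u} → N} (h : IsIteratedPower U N cls)
    (hU : ∀ k, ∀ᶠ ξ in (U : Filter o.ToType), k < ξ) (hα : α < θ) :
    α.toZFSet ∈ (cls (FinFun.const o.toZFSet)).1 := by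
  let G (i : θ.ToType) : FinFun o.ToType θ.ToType ZFSet.{u} :=
    ⟨fun x => (x i).toOrd.1.toZFSet, (FinDep.eval i).comp fun k : o.ToType => k.toOrd.1.toZFSet⟩
  have hG : ∀ i, (cls (G i)).1 ∈ (cls (FinFun.const o.toZFSet)).1 := fun i =>
    (h.mem_iff _ _).2 <| almostAll_of_forall fun x =>
      Ordinal.toZFSet_mem_toZFSet_iff.2 (x i).toOrd.2
  have hord : (cls (FinFun.const o.toZFSet)).1.IsOrdinal :=
    (h.isOrdinal_iff _).2 (almostAll_const.2 (ZFSet.isOrdinal_toZFSet o))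
  have hlt : ∀ i j, i < j → (cls (G i)).1.rank < (cls (G j)).1.rank := fun i j hij =>
    ZFSet.rank_lt_of_mem <| (h.mem_iff _ _).2 <| (almostAll_lt hU hij).mono
      ((G i).2.comp₂ (G j).2 (· ∈ ·)) fun x hx => by
        simpa [G, Ordinal.toZFSet_mem_toZFSet_iff] using hx
  -- A strictly increasing map from `θ` to the ordinals lies above the identity.
  have hle : ∀ i : θ.ToType, i.toOrd.1 ≤ (cls (G i)).1.rank := by
    intro i
    induction i using WellFoundedLT.induction with
    | _ i ih =>
      refine le_of_forall_lt fun γ hγ => ?_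
      have hi : Ordinal.ToType.mk ⟨γ, hγ.trans i.toOrd.2⟩ < i := by
        rw [← Ordinal.ToType.mk.symm.lt_iff_lt, OrderIso.symm_apply_apply]
        exact hγ
      refine lt_of_le_of_lt ?_ (hlt _ _ hi)
      simpa [Ordinal.ToType.toOrd] using ih _ hi
  rw [← hord.toZFSet_rank_eq, Ordinal.toZFSet_mem_toZFSet_iff]
  refine lt_of_le_of_lt ?_ (ZFSet.rank_lt_of_mem (hG (Ordinal.ToType.mk ⟨α, hα⟩)))
  simpa [Ordinal.ToType.toOrd] using hle (Ordinal.ToType.mk ⟨α, hα⟩)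

theorem hasHeight_image (h : IsIteratedPower U N cls) {M : SetStr.{u}} {α : Ordinal.{u}}
    (hM : M.HasHeight α) :
    (M.image fun a => cls (FinFun.const a)).HasHeight
      (cls (FinFun.const α.toZFSet)).1.rank := by
  have hord : (cls (FinFun.const α.toZFSet)).1.IsOrdinal :=
    (h.isOrdinal_iff _).2 (almostAll_const.2 (ZFSet.isOrdinal_toZFSet α))
  rw [SetStr.HasHeight, hord.toZFSet_rank_eq]
  rw [SetStr.HasHeight] at hM
  ext y
  rw [ZFSet.mem_sep]
  constructor
  · rintro ⟨hy, hy'⟩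
    obtain ⟨G, rfl, hG⟩ := h.exists_of_mem hy
    rw [h.isOrdinal_iff] at hy'
    refine (h.mem_iff _ _).2 (hG.mono₂ hy' (G.2.comp (· ∈ α.toZFSet)) fun x hx hx' => ?_)
    rw [← hM]
    exact ZFSet.mem_sep.2 ⟨hx, hx'⟩
  · intro hy
    refine ⟨h.const_subset_const.2 ?_ hy, hord.mem hy⟩
    rw [← hM]
    exact fun z hz => (ZFSet.mem_sep.1 hz).1

theorem isTransitive_image (h : IsIteratedPower U N cls) {M : SetStr.{u}} (hM : M.IsTransitive) :
    (M.image fun a => cls (FinFun.const a)).IsTransitive :=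
  ⟨(h.isTransitive_iff _).2 (almostAll_const.2 hM.1), h.const_subset_const.2 hM.2⟩

/-- The map that represents `j(M)` as a reduced power of `M`. -/
def domMap (h : IsIteratedPower U N cls) (M : SetStr.{u}) (F : FinFun K I M.Dom) :
    (M.image fun a => cls (FinFun.const a)).Dom :=
  ⟨(cls ⟨_, F.2.comp Subtype.val⟩).1,
    (h.mem_iff _ (FinFun.const M.carrier)).2 (almostAll_of_forall fun x => (F.1 x).2)⟩

/-- Since `j(M)` is itself a reduced power of `M`, Łoś's theorem applied to `M` gives elementarity
of `j ↾ M` directly, without relativising formulas to `M`. -/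
theorem isReducedPower_domMap (h : IsIteratedPower U N cls) (M : SetStr.{u}) :
    IsReducedPower U memPredLang (h.domMap M) where
  surjective := by
    classical
    rintro ⟨y, hy⟩
    obtain ⟨G, rfl, hG⟩ := h.exists_of_mem hy
    obtain ⟨x₀, hx₀⟩ := hG.exists
    -- A representative of a member of `j(M)` is made `M`-valued by changing it where it leaves `M`.
    refine ⟨⟨_, G.2.comp fun a => if ha : a ∈ M.carrier then (⟨a, ha⟩ : M.Dom) else
      ⟨G.1 x₀, hx₀⟩⟩, Subtype.ext (Subtype.ext_iff.1 ((h.eq_iff ⟨_, _⟩ G).2 ?_) :)⟩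
    refine hG.mono (G.2.comp fun a => (if ha : a ∈ M.carrier then (⟨a, ha⟩ : M.Dom) else
      ⟨G.1 x₀, hx₀⟩).1 = a) fun x hx => ?_
    have hx' : G.1 x ∈ M.carrier := hx
    simp only [dif_pos hx']
  eq_iff F G := by
    have h' := h.eq_iff ⟨_, F.2.comp Subtype.val⟩ ⟨_, G.2.comp Subtype.val⟩
    have hval : (fun x => F.1 x = G.1 x) = fun x => (F.1 x).1 = (G.1 x).1 :=
      funext fun x => propext Subtype.ext_iff
    rw [hval, ← h']
    exact ⟨fun e => Subtype.ext (congrArg Subtype.val e :),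
      fun e => Subtype.ext (congrArg Subtype.val e :)⟩
  relMap_iff := fun {n} (R : MemPredRel n) F => match n, R, F with
    | _, MemPredRel.mem, F => h.mem_iff ⟨_, (F 0).2.comp Subtype.val⟩ ⟨_, (F 1).2.comp Subtype.val⟩
    | _, MemPredRel.pred, F => h.mem_iff ⟨_, (F 0).2.comp Subtype.val⟩ (FinFun.const M.pred)

end IsIteratedPower

/-! ### Measures on `κ` and the conclusion -/

theorem IsMeasureOn.eventually_lt {κ : Cardinal.{u}} {U : Ultrafilter κ.ord.ToType}
    (hU : IsMeasureOn κ U) (k : κ.ord.ToType) : ∀ᶠ ξ in (U : Filter κ.ord.ToType), k < ξ := by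
  have := hU.1
  have hne : ∀ η, ∀ᶠ ξ in (U : Filter κ.ord.ToType), ¬ ξ = η := fun η =>
    Ultrafilter.eventually_not.2 (hU.2 η)
  -- Initial segments have size below `κ`, so `κ`-completeness lets all their points be avoided at
  -- once.
  have hlt : ∀ᶠ ξ in (U : Filter κ.ord.ToType), ∀ η ∈ Set.Iio k, ¬ ξ = η :=
    (Filter.eventually_cardinal_ball (by simpa using mk_Iio_lt k (by simp))).2 fun η _ => hne η
  filter_upwards [hlt, hne k] with ξ h₁ h₂
  exact lt_of_le_of_ne (le_of_not_gt fun h => h₁ ξ h rfl) (Ne.symm h₂)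

/-- The iterated ultrapower of the universe, and its action on a set structure of height at least
`κ`. -/
theorem exists_iteratedUltrapower {κ : Cardinal.{u}} (hκ : ℵ₀ < κ) {M : SetStr.{u}}
    {α : Ordinal.{u}} (hM : M.IsTransitive) (hα : M.HasHeight α) (hκα : κ.ord ≤ α)
    {U : Ultrafilter κ.ord.ToType} (hU : IsMeasureOn κ U) {θ : Ordinal.{u}} (hθ : α < θ) :
    ∃ (N : Set ZFSet.{u}) (j : ZFSet.{u} ↪ₑ[memLang] N),
      IsIteratedUltrapower U θ N j ∧
      IsCriticalPoint j κ.ord ∧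
      α.toZFSet ∈ (j κ.ord.toZFSet : ZFSet.{u}) ∧
      (M.image j).IsTransitive ∧
      (∃ β, α < β ∧ (M.image j).HasHeight β) ∧
      ∃ e : M.Dom ↪ₑ[memPredLang] (M.image j).Dom,
        (∀ x : M.Dom, (e x).1 = (j x.1 : ZFSet.{u})) ∧ SetStr.Nontrivial e := by
  have := hU.1
  have : CountableInterFilter (U : Filter κ.ord.ToType) :=
    CardinalInterFilter.toCountableInterFilter _ hκ
  obtain ⟨N, cls, h⟩ := exists_isIteratedPower (I := θ.ToType) (U := U)
  have hmem : α.toZFSet ∈ (cls (FinFun.const κ.ord.toZFSet)).1 :=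
    h.toZFSet_mem_const_toZFSet (hU.eventually_lt) hθ
  have hlt : α < (cls (FinFun.const α.toZFSet)).1.rank := by
    rw [← Ordinal.rank_toZFSet α]
    refine ZFSet.rank_lt_of_mem ?_
    rw [Ordinal.rank_toZFSet α]
    -- `α ∈ j(κ) ⊆ j(α)`, as `κ ≤ α`.
    exact h.const_subset_const.2 (Ordinal.toZFSet_subset_toZFSet_iff.2 hκα) hmem
  have hheight := h.hasHeight_image hα
  refine ⟨N, h.isReducedPower.elementaryEmbedding,
    ⟨h.mem_of_mem, cls, h.surjective, h.eq_iff, h.mem_iff, fun _ => rfl⟩,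
    ⟨fun heq => ?_, fun β hβ => h.const_toZFSet hβ⟩, hmem, h.isTransitive_image hM,
    ⟨_, hlt, hheight⟩, (h.isReducedPower_domMap M).elementaryEmbedding, fun _ => rfl,
    .inl fun heq => ?_⟩
  · have : α.toZFSet ∈ κ.ord.toZFSet := heq ▸ hmem
    exact hκα.not_gt (Ordinal.toZFSet_mem_toZFSet_iff.1 this)
  -- If `j(M) = M`, the two heights would agree.
  · refine hlt.ne (Ordinal.toZFSet_injective (hα.symm.trans (Eq.trans ?_ hheight)))
    exact congrArg (ZFSet.sep ZFSet.IsOrdinal) heq.symm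

end TransitiveSpectra

theorem mainTheorem7 (κ : Cardinal.{u}) (hκ : IsMeasurableCardinal κ) :
    Sp.{u} ∪ S.{u} ⊆ Set.Iio κ.ord ∧
    ∀ (M : SetStr.{u}) (α : Ordinal.{u}), M.IsTransitive → M.HasHeight α → κ.ord ≤ α →
      ∀ U : Ultrafilter κ.ord.ToType, IsMeasureOn κ U → ∀ θ : Ordinal.{u}, α < θ →
        ∃ (N : Set ZFSet.{u}) (j : ZFSet.{u} ↪ₑ[memLang] N),
          IsIteratedUltrapower U θ N j ∧
          IsCriticalPoint j κ.ord ∧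
          α.toZFSet ∈ (j κ.ord.toZFSet : ZFSet.{u}) ∧
          (M.image j).IsTransitive ∧
          (∃ β, α < β ∧ (M.image j).HasHeight β) ∧
          ∃ e : M.Dom ↪ₑ[memPredLang] (M.image j).Dom,
            (∀ x : M.Dom, (e x).1 = (j x.1 : ZFSet.{u})) ∧ SetStr.Nontrivial e := by
  obtain ⟨hκ₀, U, hU⟩ := hκ
  refine ⟨?_, fun M α hM hα hκα U hU θ hθ => exists_iteratedUltrapower hκ₀ hM hα hκα hU hθ⟩
  rintro α (⟨T, -, M, hM, -, hα, hmax⟩ | ⟨T, -, ⟨M, hM, hT, hα⟩, hub⟩) <;>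
  by_contra hκα
  -- Any length `θ > α` suffices; `α + 1` is taken.
  · obtain ⟨N, j, -, -, -, htr, -, e, -, he⟩ := exists_iteratedUltrapower hκ₀ hM hα
      (not_lt.1 hκα) hU (Order.lt_succ α)
    exact hmax ⟨_, htr, e, he⟩
  · obtain ⟨N, j, -, -, -, htr, ⟨β, hβ, hβ'⟩, e, -, -⟩ := exists_iteratedUltrapower hκ₀ hM hα
      (not_lt.1 hκα) hU (Order.lt_succ α)
    exact hβ.not_ge (hub ⟨_, htr, (e.theory_model_iff T).1 hT, hβ'⟩)
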